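/- Let $r\ge 2$, $N=2r$, and let $\mathcal{C}l_{2r}$ be the complex Clifford algebra with unit $I$ and generators $\Gamma_1,\dots,\Gamma_{2r}$ satisfying $\Gamma_i\Gamma_j+\Gamma_j\Gamma_i=2\delta_{ij}I$. Let $\rho$ be an irreducible representation of $\mathcal{C}l_{2r}$ on a complex vector space $V$ (unique up to equivalence, of dimension $2^r$). Let $so_{2r}$ be the Lie algebra of skew-symmetric complex $2r\times 2r$ matrices, spanned by $M_{ij}=E_{ij}-E_{ji}$, embedded in $\mathcal{C}l_{2r}$ by $M_{ij}\mapsto\frac14[\Gamma_i,\Gamma_j]$; the restriction of $\rho$ to $so_{2r}$ is the Dirac spinor representation $\rho=\Delta_+\oplus\Delta_-$. For any basis $\{X_A\}$ of $so_{2r}$, let $\mathsf g_{AB}=\operatorname{tr}(\operatorname{ad}X_A\operatorname{ad}X_B)$ be the Cartan--Killing metric, $\overline{\mathsf g}^{AB}$ its inverse, and $$\widehat C=\sum_{A,B}\overline{\mathsf g}^{AB}X_A\otimes X_B\in \mathcal U(so_{2r})\otimes\mathcal U(so_{2r}),\qquad \widehat C_\rho=(\rho\otimes\rho)\widehat C\in\operatorname{End}(V\otimes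 V).$$ For $k\ge 0$ let $$I_k=\sum_{i_1,\dots,i_k=1}^{2r}\rho(\Gamma_{[i_1\dots i_k]})\otimes\rho(\Gamma_{[i_1\dots i_k]}),\qquad \Gamma_{[i_1\dots i_k]}=\frac1{k!}\sum_{\sigma\in S_k}\operatorname{sgn}(\sigma)\,\Gamma_{i_{\sigma(1)}}\cdots\Gamma_{i_{\sigma(k)}},$$ with $I_0$ the identity of $V\otimes V$. Define polynomials $I_{2k}(x)\in\mathbb C[x]$ by $I_0(x)=1$, $I_2(x)=-16(2r-2)x$ and, for $k\ge 1$, $$I_{2k+2}(x)=I_{2k}(x)I_2(x)-8k(r-k)I_{2k}(x)-4k(2k-1)(r+1-k)(2r+1-2k)I_{2k-2}(x).$$ Then: 1. For every $k\ge 0$ the polynomial $I_{2k}(x)$ has degree $k$, and $I_{2k}=I_{2k}(\widehat C_\rho)$. 2. $I_{2r+2}(\widehat C_\rho)=0$. 3. This is the characteristic identity of $\widehat C_\rho$: up to a nonzero constant factor, $I_{2r+2}(x)$ is the product $\prod_c(x-c)$ over all distinct eigenvalues $c$ of $\widehat C_\rho$, and its degree is the least among all nonzero polynomials that annihilate $\widehat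 C_\rho$. -/

import Mathlib

open scoped TensorProduct
open Polynomial

attribute [local instance 100] LieRing.ofAssociativeRing

noncomputable section

namespace SpinorCasimir

/-! ### The split Casimir operator of a complex Lie algebra -/

section Casimir

variable {L : Type*} [LieRing L] [LieAlgebra ℂ L] {κ : Type*} [Fintype κ] [DecidableEq κ]

/-- The Cartan-Killing metric `g_{AB} = tr (ad X_A ∘ ad X_B)` in a basis `X_A`. -/
def killingMetric (X : Module.Basis κ ℂ L) : Matrix κ κ ℂ :=
  Matrix.of fun A B => killingForm ℂ L (X A) (X B)

/-- The split Casimir element `∑_{A,B} ḡ^{AB} X_A ⊗ X_B` of `U(L) ⊗ U(L)`, where `ḡ` is the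
inverse of the Cartan-Killing metric. -/
def splitCasimir (X : Module.Basis κ ℂ L) :
    UniversalEnvelopingAlgebra ℂ L ⊗[ℂ] UniversalEnvelopingAlgebra ℂ L :=
  ∑ A, ∑ B, (killingMetric X)⁻¹ A B •
    (UniversalEnvelopingAlgebra.ι ℂ (X A) ⊗ₜ[ℂ] UniversalEnvelopingAlgebra.ι ℂ (X B))

/-- The operator `(T ⊗ T) Ĉ` on `V ⊗ V`, for a representation `T` of `L` on `V`. -/
def splitCasimirOp (X : Module.Basis κ ℂ L) {V : Type*} [AddCommGroup V] [Module ℂ V]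
    (T : L →ₗ⁅ℂ⁆ Module.End ℂ V) : Module.End ℂ (V ⊗[ℂ] V) :=
  Module.endTensorEndAlgHom (R := ℂ) (A := ℂ) (S := ℂ) (M := V) (N := V)
    (Algebra.TensorProduct.map (UniversalEnvelopingAlgebra.lift ℂ T)
      (UniversalEnvelopingAlgebra.lift ℂ T) (splitCasimir X))

end Casimir

/-- `p(T) = 0` is the characteristic identity of the operator `T`: the polynomial `p` annihilates
`T`; up to a nonzero constant factor it is the product of `X - c` over all distinct eigenvalues `c`
of `T`; and its degree is the least among the nonzero polynomials that annihilate `T`. -/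
def IsCharacteristicIdentity {W : Type*} [AddCommGroup W] [Module ℂ W]
    (T : Module.End ℂ W) (p : ℂ[X]) : Prop :=
  aeval T p = 0 ∧
  (∃ s : Finset ℂ, (∀ c : ℂ, c ∈ s ↔ T.HasEigenvalue c) ∧
    ∃ a : ℂ, a ≠ 0 ∧ p = C a * ∏ c ∈ s, (X - C c)) ∧
  ∀ q : ℂ[X], q ≠ 0 → aeval T q = 0 → p.degree ≤ q.degree

/-! ### The complex Clifford algebra and `so_n` inside it -/

/-- The quadratic form `∑ i, x_i ^ 2` on `ℂ^n`. -/
def stdForm (n : ℕ) : QuadraticForm ℂ (Fin n → ℂ) :=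
  QuadraticMap.weightedSumSquares ℂ (fun _ : Fin n => (1 : ℂ))

/-- The complex Clifford algebra with `n` generators. -/
abbrev Cl (n : ℕ) : Type := CliffordAlgebra (stdForm n)

/-- The generators `Γ_i`. -/
def gamma {n : ℕ} (i : Fin n) : Cl n :=
  CliffordAlgebra.ι (stdForm n) (Pi.single i 1)

theorem gamma_mul_add_swap {n : ℕ} (i j : Fin n) :
    (gamma i : Cl n) * gamma j + gamma j * gamma i = (if i = j then (2 : ℂ) else 0) • 1 := by
  unfold gamma
  rw [CliffordAlgebra.ι_mul_ι_add_swap, Algebra.algebraMap_eq_smul_one]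
  congr 1
  simp only [QuadraticMap.polar, stdForm, QuadraticMap.weightedSumSquares_apply, Pi.add_apply,
    one_smul]
  rw [← Finset.sum_sub_distrib, ← Finset.sum_sub_distrib]
  have h : ∀ k : Fin n, ((Pi.single i (1 : ℂ) : Fin n → ℂ) k + (Pi.single j (1 : ℂ) : Fin n → ℂ) k)
      * ((Pi.single i (1 : ℂ) : Fin n → ℂ) k + (Pi.single j (1 : ℂ) : Fin n → ℂ) k)
      - (Pi.single i (1 : ℂ) : Fin n → ℂ) k * (Pi.single i (1 : ℂ) : Fin n → ℂ) k
      - (Pi.single j (1 : ℂ) : Fin n → ℂ) k * (Pi.single j (1 : ℂ) : Fin n → ℂ) k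
      = if k = i then (if i = j then (2 : ℂ) else 0) else 0 := by
    intro k
    by_cases hi : k = i
    · subst hi
      by_cases hj : k = j
      · subst hj; simp; norm_num
      · simp [hj]
    · simp [hi]
  simp only [h, Finset.sum_ite_eq', Finset.mem_univ, if_true]

/-- The antisymmetrised products
`Γ_{[i_1 … i_k]} = (1 / k!) ∑_σ sign(σ) Γ_{i_σ(1)} ⋯ Γ_{i_σ(k)}` (the unit for `k = 0`). -/
def gammaAntisymm {n k : ℕ} (i : Fin k → Fin n) : Cl n :=
  ((k.factorial : ℂ)⁻¹) • ∑ σ : Equiv.Perm (Fin k),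
    ((Equiv.Perm.sign σ : ℤ) : ℂ) • (List.ofFn fun a => gamma (i (σ a))).prod

/-- The element `M_{ij} = (1 / 4) [Γ_i, Γ_j]` of the Clifford algebra. -/
def spinM {n : ℕ} (i j : Fin n) : Cl n :=
  (4 : ℂ)⁻¹ • ⁅(gamma i : Cl n), (gamma j : Cl n)⁆

theorem spinM_lie_gamma {n : ℕ} (i j k : Fin n) :
    ⁅(spinM i j : Cl n), (gamma k : Cl n)⁆ =
      (if j = k then (1 : ℂ) else 0) • gamma i - (if i = k then (1 : ℂ) else 0) • gamma j := by
  have h1 := gamma_mul_add_swap i j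
  have h2 := gamma_mul_add_swap j k
  have h3 := gamma_mul_add_swap i k
  have e : ∀ (p : Prop) [Decidable p], (if p then (2 : ℂ) else 0) = 2 * (if p then (1 : ℂ) else 0) := by
    intro p _; split_ifs <;> simp
  rw [e] at h1 h2 h3
  generalize (if i = j then (1 : ℂ) else 0) = a at *
  generalize (if j = k then (1 : ℂ) else 0) = b at *
  generalize (if i = k then (1 : ℂ) else 0) = c at *
  simp only [spinM, Ring.lie_def]
  generalize (gamma i : Cl n) = x at *
  generalize (gamma j : Cl n) = y at *
  generalize (gamma k : Cl n) = z at *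
  have h1' : y * x = (2 * a) • 1 - x * y := by rw [← h1]; abel
  have h2' : z * y = (2 * b) • 1 - y * z := by rw [← h2]; abel
  have h3' : z * x = (2 * c) • 1 - x * z := by rw [← h3]; abel
  have k1 : z * (x * y) = (2 * c) • y - (2 * b) • x + x * y * z := by
    rw [← mul_assoc, h3', sub_mul, mul_assoc x z y, h2', mul_sub, smul_mul_assoc, one_mul,
      mul_smul_comm, mul_one, mul_assoc]
    abel
  rw [h1', smul_mul_assoc, mul_smul_comm, sub_mul, sub_mul, mul_sub, mul_sub, k1, smul_mul_assoc,
    mul_smul_comm, one_mul, mul_one]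
  module

/-- The elements `M_{ij}` of `so_n` are the matrices `E_{ij} - E_{ji}`. The embedding of `so_n` into
the Clifford algebra sends `E_{ij} - E_{ji}` to `(1 / 4) [Γ_i, Γ_j]`, that is
`A = (1 / 2) ∑ A_{ij} (E_{ij} - E_{ji})` to `(1 / 2) ∑ A_{ij} M_{ij}`. -/
def spinLinear (n : ℕ) : Matrix (Fin n) (Fin n) ℂ →ₗ[ℂ] Cl n where
  toFun A := (2 : ℂ)⁻¹ • ∑ i, ∑ j, A i j • spinM i j
  map_add' A B := by
    simp only [Matrix.add_apply, add_smul, Finset.sum_add_distrib, smul_add]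
  map_smul' c A := by
    simp only [Matrix.smul_apply, smul_eq_mul, mul_smul, ← Finset.smul_sum, RingHom.id_apply]
    rw [smul_comm]

theorem spinM_antisymm {n : ℕ} (i j : Fin n) : (spinM i j : Cl n) = - spinM j i := by
  rw [spinM, spinM, ← lie_skew, smul_neg]

theorem spinLinear_lie_gamma {n : ℕ} (A : Matrix (Fin n) (Fin n) ℂ) (hA : A.transpose = -A)
    (k : Fin n) : ⁅spinLinear n A, (gamma k : Cl n)⁆ = ∑ i, A i k • gamma i := by
  have hA' : ∀ i j, A j i = - A i j := fun i j => congrFun (congrFun hA i) j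
  change ⁅(2 : ℂ)⁻¹ • ∑ i, ∑ j, A i j • spinM i j, (gamma k : Cl n)⁆ = _
  simp only [smul_lie, sum_lie, spinM_lie_gamma, smul_sub, Finset.sum_sub_distrib, ite_smul,
    one_smul, zero_smul, smul_ite, smul_zero, Finset.sum_ite_eq',
    Finset.mem_univ, if_true]
  rw [Finset.sum_comm (f := fun i j => if i = k then A i j • (gamma j : Cl n) else 0)]
  simp only [Finset.sum_ite_eq', Finset.mem_univ, if_true]
  rw [← smul_sub, ← Finset.sum_sub_distrib, Finset.smul_sum]
  refine Finset.sum_congr rfl fun i _ => ?_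
  rw [hA' i k]
  module

theorem spinLinear_lie {n : ℕ} (A B : Matrix (Fin n) (Fin n) ℂ) (hA : A.transpose = -A) :
    spinLinear n ⁅A, B⁆ = ⁅spinLinear n A, spinLinear n B⁆ := by
  have hA' : ∀ i j, A j i = - A i j := fun i j => congrFun (congrFun hA i) j
  have key : ∀ k l, ⁅spinLinear n A, (spinM k l : Cl n)⁆ =
      ∑ i, A i k • spinM i l + ∑ i, A i l • spinM k i := by
    intro k l
    simp only [spinM, lie_smul]
    rw [leibniz_lie, spinLinear_lie_gamma A hA, spinLinear_lie_gamma A hA]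
    simp only [sum_lie, lie_sum, smul_lie, lie_smul, smul_add, Finset.smul_sum]
    congr 1 <;> exact Finset.sum_congr rfl fun i _ => smul_comm _ _ _
  conv_rhs => rw [show spinLinear n B = (2 : ℂ)⁻¹ • ∑ i, ∑ j, B i j • spinM i j from rfl]
  change (2 : ℂ)⁻¹ • ∑ i, ∑ j, ⁅A, B⁆ i j • spinM i j = _
  simp only [lie_smul, lie_sum, key, smul_add, Finset.sum_add_distrib, Finset.smul_sum]
  have s1 : ∑ k, ∑ l, ∑ i, (2 : ℂ)⁻¹ • B k l • A i k • (spinM i l : Cl n)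
      = ∑ i, ∑ l, ∑ k, (2 : ℂ)⁻¹ • B k l • A i k • (spinM i l : Cl n) := by
    rw [Finset.sum_comm]
    conv_lhs => enter [2, l]; rw [Finset.sum_comm]
    rw [Finset.sum_comm]
  have s2 : ∑ k, ∑ l, ∑ i, (2 : ℂ)⁻¹ • B k l • A i l • (spinM k i : Cl n)
      = ∑ k, ∑ i, ∑ l, (2 : ℂ)⁻¹ • B k l • A i l • (spinM k i : Cl n) :=
    Finset.sum_congr rfl fun k _ => Finset.sum_comm
  rw [s1, s2, ← Finset.sum_add_distrib]
  refine Finset.sum_congr rfl fun i _ => ?_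
  rw [← Finset.sum_add_distrib]
  refine Finset.sum_congr rfl fun j _ => ?_
  rw [← Finset.sum_add_distrib, Ring.lie_def, Matrix.sub_apply, Matrix.mul_apply, Matrix.mul_apply,
    ← Finset.sum_sub_distrib, Finset.sum_smul, Finset.smul_sum]
  refine Finset.sum_congr rfl fun k _ => ?_
  rw [hA' k j]
  module

/-- The embedding of the Lie algebra `so_n` (skew-symmetric complex matrices) into the Clifford
algebra. -/
def spinHom (n : ℕ) : LieAlgebra.Orthogonal.so (Fin n) ℂ →ₗ⁅ℂ⁆ Cl n where
  toLinearMap := (spinLinear n).comp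
    ((LieAlgebra.Orthogonal.so (Fin n) ℂ).toSubmodule.subtype)
  map_lie' {A B} := spinLinear_lie (A : Matrix (Fin n) (Fin n) ℂ) B
    ((LieAlgebra.Orthogonal.mem_so (Fin n) ℂ _).1 A.2)

/-! ### Spinor operators, for a module `V` over the Clifford algebra -/

section Spinor

variable (n : ℕ) (V : Type*) [AddCommGroup V] [Module ℂ V] [Module (Cl n) V]
  [IsScalarTower ℂ (Cl n) V]

/-- The representation `ρ` of the Clifford algebra on its module `V`. -/
def cliffordRep : Cl n →ₐ[ℂ] Module.End ℂ V := Algebra.lsmul ℂ ℂ V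

/-- The restriction of `ρ` to the Lie algebra `so_n`. -/
def spinorRep : LieAlgebra.Orthogonal.so (Fin n) ℂ →ₗ⁅ℂ⁆ Module.End ℂ V :=
  ((cliffordRep n V : Cl n →ₗ⁅ℂ⁆ Module.End ℂ V)).comp (spinHom n)

/-- The invariants `I_k = ∑_{i_1,…,i_k} ρ(Γ_{[i_1 … i_k]}) ⊗ ρ(Γ_{[i_1 … i_k]})`, as operators on
`V ⊗ V`. -/
def invariantI (k : ℕ) : Module.End ℂ (V ⊗[ℂ] V) :=
  ∑ i : Fin k → Fin n,
    TensorProduct.map (cliffordRep n V (gammaAntisymm i)) (cliffordRep n V (gammaAntisymm i))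

end Spinor

/-- The polynomial `I_{2k}(x)` (for `so_{2r}`), determined by `I_0 = 1`, `I_2 = -16 (2r - 2) x` and
`I_{2k} I_2 = I_{2k+2} + 8k(r-k) I_{2k} + 4k(2k-1)(r+1-k)(2r+1-2k) I_{2k-2}` for `k ≥ 1`. -/
def evenInvariantPoly (r : ℕ) : ℕ → ℂ[X]
  | 0 => 1
  | 1 => C (-16 * (2 * (r : ℂ) - 2)) * X
  | m + 2 =>
    let k : ℂ := (m : ℂ) + 1
    evenInvariantPoly r (m + 1) * (C (-16 * (2 * (r : ℂ) - 2)) * X)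
      - C (8 * k * (r - k)) * evenInvariantPoly r (m + 1)
      - C (4 * k * (2 * k - 1) * (r + 1 - k) * (2 * r + 1 - 2 * k)) * evenInvariantPoly r m

end SpinorCasimir

end

/-!
Put `T_i = ρ(Γ_i) ⊗ ρ(Γ_i)`. The sign in `Γ_i Γ_j = -Γ_j Γ_i` appears twice in a tensor square, so
the `T_i` are commuting involutions of `V ⊗ V`. As `Γ_{[i_1 … i_k]}` is the plain product for
distinct indices and vanishes otherwise, `I_k` is the sum of `T_{i_1} ⋯ T_{i_k}` over tuples of
distinct indices, `k!` times the elementary symmetric function of the `T_i` (`invariantI_eq_distinctSum`).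

* In any commutative ring, involutions `t_i` satisfy
  `(∑ t_i) J_{k+1} = J_{k+2} + (k+1)(n-k) J_k` for these sums `J_k` (`sum_mul_distinctSum`). Two
  steps of it give the recurrence that defines the polynomials (`distinctSum_add_two`), and
  `J_k = 0` for `k > n`.
* The Killing form of `so_n` is `(n - 2) tr(xy)` (`killingForm_so`). Therefore
  `∑ B(y, u_p) w_p = y` holds for `w_p = E_{ij} - E_{ji}` and suitable multiples `u_p` of them, a
  property which determines the split Casimir element independently of the basis
  (`sum_gram_inv_eq`). It follows that `I_2 = -16 (n - 2) Ĉ` (`splitCasimirOp_spinorRep`), hence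
  `I_{2k} = I_{2k}(Ĉ)` and `I_{2r+2}(Ĉ) = 0`.
* For even `n` the invertible operator `ρ(Γ_a ω) ⊗ 1`, with `ω` the product of all generators,
  anticommutes with `T_a` and commutes with the other `T_i`. Hence every choice of signs occurs
  as the joint eigenvalues of the `T_i` on some nonzero vector (`exists_joint_eigenvector`), and
  since `I_2 = (∑ T_i)² - n`, the operator `Ĉ` has the `r + 1` distinct eigenvalues
  `-((2r - 2m)² - 2r) / (16 (2r - 2))`, `0 ≤ m ≤ r`. They are all roots of every polynomial that
  annihilates `Ĉ`, and `I_{2r+2}` has degree `r + 1`, so it has no other roots and the least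
  possible degree (`isCharacteristicIdentity_of_hasEigenvalue`).
-/

noncomputable section

namespace SpinorCasimir

/-! ### Sums over tuples of distinct indices -/

section InjectiveSums

variable {R : Type*} [CommRing R] {n : ℕ}

theorem insertNth_injective_iff {α : Type*} {k : ℕ} (p : Fin (k + 1)) (x : α) (f : Fin k → α) :
    Function.Injective (p.insertNth x f : Fin (k + 1) → α) ↔
      Function.Injective f ∧ x ∉ Set.range f := by
  constructor
  · intro h
    refine ⟨fun a b hab => ?_, ?_⟩
    · have : p.succAbove a = p.succAbove b := h (by simpa using hab)
      exact Fin.succAbove_right_injective this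
    · rintro ⟨a, ha⟩
      have : p.succAbove a = p := h (by simpa using ha)
      exact Fin.succAbove_ne p a this
  · rintro ⟨hf, hx⟩
    intro a b
    induction a using p.succAboveCases with
    | x =>
      induction b using p.succAboveCases with
      | x => simp
      | p b => intro h; exact absurd ⟨b, by simpa using h.symm⟩ hx
    | p a =>
      induction b using p.succAboveCases with
      | x => intro h; exact absurd ⟨a, by simpa using h⟩ hx
      | p b => intro h; exact congrArg _ (hf (by simpa using h))

open Classical in
/-- The sum of `t_{i_1} ⋯ t_{i_k}` over all tuples of pairwise distinct indices, that is `k!` times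
the `k`-th elementary symmetric function of the `t_i`. -/
def distinctSum (t : Fin n → R) (k : ℕ) : R :=
  ∑ i : Fin k → Fin n, if Function.Injective i then ∏ a, t (i a) else 0

theorem distinctSum_zero (t : Fin n → R) : distinctSum t 0 = 1 := by
  simp [distinctSum, Function.injective_of_subsingleton]

theorem distinctSum_one (t : Fin n → R) : distinctSum t 1 = ∑ i, t i := by
  rw [distinctSum, ← (Equiv.funUnique (Fin 1) (Fin n)).symm.sum_comp]
  simp [Function.injective_of_subsingleton]

theorem distinctSum_eq_zero (t : Fin n → R) {k : ℕ} (hk : n < k) : distinctSum t k = 0 := by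
  refine Finset.sum_eq_zero fun i _ => if_neg fun hi => ?_
  have := Fintype.card_le_of_injective i hi
  simp at this
  omega

open Classical in
theorem sum_not_mem_range {k : ℕ} (i : Fin k → Fin n) (hi : Function.Injective i) (c : R) :
    ∑ x, (if x ∉ Set.range i then c else 0) = ((n : R) - k) * c := by
  have h : ∑ x, (if x ∈ Set.range i then c else 0) = k * c := by
    rw [← Finset.sum_filter, Finset.sum_const, nsmul_eq_mul]
    congr 2
    rw [show Finset.univ.filter (· ∈ Set.range i) = Finset.univ.image i by ext; simp,
      Finset.card_image_of_injective _ hi]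
    simp
  have h2 : ∑ x, ((if x ∉ Set.range i then c else 0) + (if x ∈ Set.range i then c else 0))
      = n * c := by
    rw [Finset.sum_congr rfl (g := fun _ => c)]
    · simp
    · intro x _; split_ifs <;> simp_all
  rw [Finset.sum_add_distrib, h] at h2
  rw [sub_mul, ← h2]; ring

/-- Multiplying by `∑ t_j` either adds a new index, or cancels one of the `k + 1` old ones
against itself because `t_j² = 1`; a tuple of `k` indices arises from `k + 1` positions and
`n - k` values of the cancelled index. -/
theorem sum_mul_distinctSum (t : Fin n → R) (ht : ∀ i, t i * t i = 1) (k : ℕ) :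
    (∑ j, t j) * distinctSum t (k + 1) =
      distinctSum t (k + 2) + (k + 1) * ((n : R) - k) * distinctSum t k := by
  classical
  -- Tuples of length `k + 2` are pairs of a tuple `i` and a new index `j`.
  have h1 : distinctSum t (k + 2) = ∑ i : Fin (k + 1) → Fin n, ∑ j,
      if Function.Injective i then (if j ∉ Set.range i then t j * ∏ a, t (i a) else 0) else 0 := by
    rw [distinctSum, ← (Fin.consEquiv fun _ => Fin n).sum_comp, Fintype.sum_prod_type_right]
    refine Finset.sum_congr rfl fun i _ => Finset.sum_congr rfl fun j _ => ?_
    simp only [Fin.consEquiv, Equiv.coe_fn_mk, Fin.cons_injective_iff, Fin.prod_univ_succ,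
      Fin.cons_zero, Fin.cons_succ]
    split_ifs <;> simp_all
  -- If `j = i_a` is an old index, the product loses its `a`-th factor, and `i` is a shorter tuple
  -- with an index inserted at the position `a`.
  have h2 : (k + 1) * ((n : R) - k) * distinctSum t k = ∑ i : Fin (k + 1) → Fin n, ∑ j,
      if Function.Injective i then (if j ∈ Set.range i then t j * ∏ a, t (i a) else 0) else 0 := by
    have e1 : ∀ i : Fin (k + 1) → Fin n, (∑ j, if Function.Injective i then
        (if j ∈ Set.range i then t j * ∏ a, t (i a) else 0) else 0)
        = ∑ a : Fin (k + 1), if Function.Injective i then ∏ b, t (i (a.succAbove b)) else 0 := by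
      intro i
      by_cases hi : Function.Injective i
      · simp only [hi, if_true]
        rw [← Finset.sum_filter,
          show Finset.univ.filter (· ∈ Set.range i) = Finset.univ.image i by ext; simp,
          Finset.sum_image fun a _ b _ h => hi h]
        refine Finset.sum_congr rfl fun a _ => ?_
        rw [Fin.prod_univ_succAbove _ a, ← mul_assoc, ht, one_mul]
      · simp [hi]
    rw [Finset.sum_congr rfl fun i _ => e1 i, Finset.sum_comm]
    have e2 : ∀ a : Fin (k + 1), (∑ i : Fin (k + 1) → Fin n,
        if Function.Injective i then ∏ b, t (i (a.succAbove b)) else 0)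
        = ((n : R) - k) * distinctSum t k := by
      intro a
      rw [← (Fin.insertNthEquiv (fun _ => Fin n) a).sum_comp, Fintype.sum_prod_type_right,
        distinctSum, Finset.mul_sum]
      refine Finset.sum_congr rfl fun i _ => ?_
      change (∑ x, if Function.Injective (a.insertNth x i : Fin (k + 1) → Fin n) then
        ∏ b, t ((a.insertNth x i : Fin (k + 1) → Fin n) (a.succAbove b)) else 0) = _
      simp only [insertNth_injective_iff, Fin.insertNth_apply_succAbove]
      by_cases hi : Function.Injective i
      · simp only [hi, true_and, if_true]
        exact sum_not_mem_range i hi _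
      · simp [hi]
    rw [Finset.sum_congr rfl fun a _ => e2 a]
    simp
    ring
  rw [h1, h2, ← Finset.sum_add_distrib, distinctSum, Finset.mul_sum]
  refine Finset.sum_congr rfl fun i _ => ?_
  rw [← Finset.sum_add_distrib, Finset.sum_mul]
  refine Finset.sum_congr rfl fun j _ => ?_
  split_ifs <;> simp_all

theorem distinctSum_two (t : Fin n → R) (ht : ∀ i, t i * t i = 1) :
    distinctSum t 2 = (∑ i, t i) ^ 2 - n := by
  have h := sum_mul_distinctSum t ht 0
  rw [distinctSum_one, distinctSum_zero] at h
  simp only [zero_add, Nat.cast_zero, sub_zero, one_mul, mul_one] at h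
  rw [sq, h]; ring

/-- The three-term recurrence for the even distinct sums, by applying the one-step recurrence
twice. -/
theorem distinctSum_add_two (t : Fin n → R) (ht : ∀ i, t i * t i = 1) (m : ℕ) :
    distinctSum t (m + 4) = distinctSum t (m + 2) * distinctSum t 2
      - 2 * (m + 2) * ((n : R) - (m + 2)) * distinctSum t (m + 2)
      - (m + 2) * (m + 1) * ((n : R) - m) * (n - m - 1) * distinctSum t m := by
  have h0 := sum_mul_distinctSum t ht m
  have h1 := sum_mul_distinctSum t ht (m + 1)
  have h2 := sum_mul_distinctSum t ht (m + 2)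
  rw [distinctSum_two t ht]
  push_cast at h1 h2
  rw [show m + 2 + 2 = m + 4 from rfl, show m + 2 + 1 = m + 3 from rfl] at h2
  rw [show m + 1 + 1 = m + 2 from rfl, show m + 1 + 2 = m + 3 from rfl] at h1
  linear_combination (-∑ i, t i) * h1 - h2 - ((m : R) + 2) * ((n : R) - m - 1) * h0

end InjectiveSums

/-! ### The split Casimir operator in an arbitrary dual pair of families -/

section Casimir

/-- Two tensors `∑ ḡ^{AB} X_A ⊗ X_B` and `∑ u_p ⊗ w_p` agree under every bilinear map as soon as
`∑ B(y, u_p) w_p = y` for all `y`, where `g` is the Gram matrix of the bilinear form `B`. -/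
theorem sum_gram_inv_eq {L W ι κ : Type*} [AddCommGroup L] [Module ℂ L] [AddCommGroup W]
    [Module ℂ W] [Fintype ι] [Fintype κ] [DecidableEq κ] (X : Module.Basis κ ℂ L)
    (B : L →ₗ[ℂ] L →ₗ[ℂ] ℂ) (u w : ι → L) (h : ∀ y, ∑ p, B y (u p) • w p = y)
    (F : L →ₗ[ℂ] L →ₗ[ℂ] W) :
    ∑ a, ∑ b, (Matrix.of fun a b => B (X a) (X b))⁻¹ a b • F (X a) (X b) = ∑ p, F (u p) (w p) := by
  let c : Matrix κ κ ℂ := Matrix.of fun a b => ∑ p, X.repr (u p) a * X.repr (w p) b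
  -- `c` holds the coefficients of `∑ u_p ⊗ w_p`; the hypothesis at `y = X_d` reads `g * c = 1`.
  have hc : (Matrix.of fun a b => B (X a) (X b))⁻¹ = c := by
    refine Matrix.inv_eq_right_inv ?_
    ext d b
    have h1 := congrArg (fun y => X.repr y b) (h (X d))
    simp only [map_sum, map_smul, Finsupp.coe_finsetSum, Finset.sum_apply, Finsupp.smul_apply,
      smul_eq_mul, Module.Basis.repr_self] at h1
    rw [Matrix.mul_apply, Matrix.one_apply, ← Finsupp.single_apply, ← h1]
    simp only [c, Matrix.of_apply, Finset.mul_sum]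
    rw [Finset.sum_comm]
    refine Finset.sum_congr rfl fun p _ => ?_
    conv_rhs => rw [← X.sum_repr (u p)]
    simp only [map_sum, map_smul, smul_eq_mul, Finset.sum_mul]
    refine Finset.sum_congr rfl fun a _ => ?_
    ring
  rw [hc]
  have h3 : ∀ p, F (u p) (w p) = ∑ a, ∑ b, (X.repr (u p) a * X.repr (w p) b) • F (X a) (X b) := by
    intro p
    conv_lhs => rw [← X.sum_repr (u p), ← X.sum_repr (w p)]
    simp only [map_sum, map_smul, LinearMap.sum_apply, LinearMap.smul_apply, mul_smul,
      Finset.smul_sum]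
    rw [Finset.sum_comm]
    exact Finset.sum_congr rfl fun a _ => Finset.sum_congr rfl fun b _ => smul_comm _ _ _
  simp only [h3, c, Matrix.of_apply, Finset.sum_smul]
  rw [Finset.sum_comm]
  conv_rhs => rw [Finset.sum_comm]
  refine Finset.sum_comm.trans ?_
  refine Finset.sum_congr rfl fun a _ => ?_
  rw [Finset.sum_comm]

/-- The split Casimir operator may be computed from any finite families `u`, `w` that are dual for
the Killing form, not only from a basis. -/
theorem splitCasimirOp_eq_sum {L ι κ V : Type*} [LieRing L] [LieAlgebra ℂ L] [Fintype ι] [Fintype κ]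
    [DecidableEq κ] [AddCommGroup V] [Module ℂ V] (X : Module.Basis κ ℂ L)
    (T : L →ₗ⁅ℂ⁆ Module.End ℂ V) (u w : ι → L)
    (h : ∀ y, ∑ p, killingForm ℂ L y (u p) • w p = y) :
    splitCasimirOp X T = ∑ p, TensorProduct.map (T (u p)) (T (w p)) := by
  have h1 := sum_gram_inv_eq X (killingForm ℂ L) u w h
    ((TensorProduct.mapBilinear (RingHom.id ℂ) V V V V).compl₁₂ (T : L →ₗ[ℂ] Module.End ℂ V)
      (T : L →ₗ[ℂ] Module.End ℂ V))
  simp only [LinearMap.compl₁₂_apply, TensorProduct.mapBilinear_apply] at h1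
  refine Eq.trans ?_ h1
  simp only [splitCasimirOp, splitCasimir, map_sum, map_smul, Algebra.TensorProduct.map_tmul,
    UniversalEnvelopingAlgebra.lift_ι_apply, Module.endTensorEndAlgHom_apply]
  rfl

end Casimir

/-! ### The Killing form of `so_n` -/

section Killing
open LieAlgebra.Orthogonal

variable {n : ℕ}

theorem trace_matrix_end (f : Module.End ℂ (Matrix (Fin n) (Fin n) ℂ)) :
    LinearMap.trace ℂ _ f = ∑ i, ∑ j, f (Matrix.single i j 1) i j := by
  rw [LinearMap.trace_eq_matrix_trace ℂ (Matrix.stdBasis ℂ (Fin n) (Fin n)), Matrix.trace,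
    Fintype.sum_prod_type]
  refine Finset.sum_congr rfl fun i _ => Finset.sum_congr rfl fun j _ => ?_
  rw [Matrix.diag_apply, LinearMap.toMatrix_apply, Matrix.stdBasis_eq_single]
  simp [Matrix.stdBasis]

/-- The projection `A ↦ (A - Aᵀ) / 2` of all matrices onto the skew-symmetric ones. -/
def skewPart (n : ℕ) : Matrix (Fin n) (Fin n) ℂ →ₗ[ℂ] so (Fin n) ℂ where
  toFun A := ⟨(2 : ℂ)⁻¹ • (A - A.transpose), by
    rw [mem_so]; simp [← smul_neg]⟩
  map_add' A B := by
    ext : 1; simp only [Matrix.transpose_add]; push_cast; module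
  map_smul' c A := by
    ext : 1; simp only [Matrix.transpose_smul, RingHom.id_apply]; push_cast; module

theorem mul_single_mul_apply (A B : Matrix (Fin n) (Fin n) ℂ) (k l i j : Fin n) :
    (A * Matrix.single k l (1 : ℂ) * B : Matrix (Fin n) (Fin n) ℂ) i j = A i k * B l j := by
  rw [Matrix.mul_assoc, Matrix.mul_apply, Finset.sum_eq_single k]
  · simp
  · intro b _ hb; simp [hb]
  · simp

/-- The trace of `ad x ∘ ad y` on `so_n` is the trace on all matrices of the map
`Z ↦ (⁅x, ⁅y, Z⁆⁆ - ⁅x, ⁅y, Zᵀ⁆⁆) / 2`, which extends it by zero to the symmetric matrices. -/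
theorem killingForm_so (x y : so (Fin n) ℂ) :
    killingForm ℂ (so (Fin n) ℂ) x y =
      ((n : ℂ) - 2) * ((x : Matrix (Fin n) (Fin n) ℂ) * y).trace := by
  set f := LieAlgebra.ad ℂ (so (Fin n) ℂ) x ∘ₗ LieAlgebra.ad ℂ (so (Fin n) ℂ) y
  let ι : so (Fin n) ℂ →ₗ[ℂ] Matrix (Fin n) (Fin n) ℂ := (so (Fin n) ℂ).toSubmodule.subtype
  have hι : skewPart n ∘ₗ ι = LinearMap.id := by
    ext z : 1
    have hz := (mem_so _ _ _).1 z.2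
    ext : 1
    change (2 : ℂ)⁻¹ •
      ((z : Matrix (Fin n) (Fin n) ℂ) - (z : Matrix (Fin n) (Fin n) ℂ).transpose) = z
    rw [hz]; module
  have htr : LinearMap.trace ℂ _ f = LinearMap.trace ℂ _ (ι ∘ₗ (f ∘ₗ skewPart n)) := by
    rw [LinearMap.trace_comp_comm' (f ∘ₗ skewPart n) ι, LinearMap.comp_assoc, hι, LinearMap.comp_id]
  rw [killingForm_apply_apply, htr, trace_matrix_end]
  obtain ⟨x, hx⟩ := x
  obtain ⟨y, hy⟩ := y
  rw [mem_so] at hx hy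
  have hx' : ∀ i j, x j i = - x i j := fun i j => congrFun (congrFun hx i) j
  have hy' : ∀ i j, y j i = - y i j := fun i j => congrFun (congrFun hy i) j
  have hx0 : ∀ i, x i i = 0 := fun i => self_eq_neg.1 (hx' i i)
  have hy0 : ∀ i, y i i = 0 := fun i => self_eq_neg.1 (hy' i i)
  have happ : ∀ i j, (ι ∘ₗ (f ∘ₗ skewPart n)) (Matrix.single i j 1) =
      ⁅x, ⁅y, (2 : ℂ)⁻¹ • (Matrix.single i j (1 : ℂ) - Matrix.single j i 1)⁆⁆ := by
    intro i j
    rw [← Matrix.transpose_single]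
    rfl
  have hexp : ∀ Z : Matrix (Fin n) (Fin n) ℂ, ⁅x, ⁅y, Z⁆⁆ =
      (x * y) * Z * 1 - x * Z * y - y * Z * x + 1 * Z * (y * x) := by
    intro Z; simp only [Ring.lie_def]; noncomm_ring
  -- The diagonal entries of `x` and `y` vanish, so of the terms `x Z y` and `y Z x` only those with
  -- the transposed matrix unit contribute.
  have hent : ∀ i j, (ι ∘ₗ (f ∘ₗ skewPart n)) (Matrix.single i j 1) i j =
      (2 : ℂ)⁻¹ * ((x * y) i i + (y * x) j j + 2 * (x i j * y i j)
        - (if i = j then (x * y) i i + (y * x) i i else 0)) := by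
    intro i j
    rw [happ, lie_smul, lie_smul, lie_sub, lie_sub, hexp, hexp]
    simp only [Matrix.smul_apply, Matrix.sub_apply, Matrix.add_apply, mul_single_mul_apply,
      smul_eq_mul, hx0, hy0, Matrix.one_apply_eq]
    by_cases h : i = j
    · subst h; simp [hx0]
    · simp [h]; ring
  simp only [hent, ← Finset.mul_sum, Finset.sum_add_distrib, Finset.sum_sub_distrib,
    Finset.sum_ite_eq, Finset.mem_univ, if_true, Finset.sum_const, Finset.card_univ,
    Fintype.card_fin, nsmul_eq_mul]
  have t1 : ∑ i, (x * y) i i = (x * y).trace := rfl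
  have t2 : ∑ i, (y * x) i i = (x * y).trace := by rw [Matrix.trace_mul_comm]; rfl
  have t3 : ∑ i, ∑ j, x i j * y i j = -(x * y).trace := by
    simp only [← t1, Matrix.mul_apply, ← Finset.sum_neg_distrib]
    refine Finset.sum_congr rfl fun i _ => Finset.sum_congr rfl fun j _ => ?_
    rw [hy' i j]; ring
  rw [t1, t2, t3]
  ring

/-- The element `E_{ij} - E_{ji}` of `so_n`. -/
def soM (i j : Fin n) : so (Fin n) ℂ :=
  ⟨Matrix.single i j 1 - Matrix.single j i 1, by
    rw [mem_so]; simp⟩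

theorem sum_smul_single_sub_single {Y : Matrix (Fin n) (Fin n) ℂ} (hY : Y.transpose = -Y) :
    ∑ i, ∑ j, (2⁻¹ * Y i j) • (Matrix.single i j (1 : ℂ) - Matrix.single j i 1) = Y := by
  have h1 : ∑ i, ∑ j, Matrix.single i j (2⁻¹ * Y i j) = (2⁻¹ : ℂ) • Y :=
    (Matrix.matrix_eq_sum_single ((2⁻¹ : ℂ) • Y)).symm
  have h2 : ∑ i, ∑ j, Matrix.single j i (2⁻¹ * Y i j) = (2⁻¹ : ℂ) • Y.transpose := by
    rw [Finset.sum_comm]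
    exact (Matrix.matrix_eq_sum_single ((2⁻¹ : ℂ) • Y.transpose)).symm
  simp only [smul_sub, Finset.sum_sub_distrib, Matrix.smul_single, smul_eq_mul, mul_one]
  rw [h1, h2, hY]
  module

/-- All the `E_{ij} - E_{ji}` together are dual to a multiple of themselves for the Killing form.
The ordered pairs `(i, j)` and `(j, i)` both occur, so that these families are not bases. -/
theorem sum_killingForm_soM (hn : (n : ℂ) - 2 ≠ 0) (y : so (Fin n) ℂ) :
    ∑ p : Fin n × Fin n, killingForm ℂ (so (Fin n) ℂ) y
      ((-(4 * ((n : ℂ) - 2))⁻¹) • soM p.1 p.2) • soM p.1 p.2 = y := by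
  have hy : ∀ i j, (y : Matrix (Fin n) (Fin n) ℂ) j i = -(y : Matrix (Fin n) (Fin n) ℂ) i j :=
    fun i j => congrFun (congrFun ((mem_so _ _ _).1 y.2) i) j
  have h1 : ∀ i j, killingForm ℂ (so (Fin n) ℂ) y (soM i j) =
      -2 * ((n : ℂ) - 2) * (y : Matrix (Fin n) (Fin n) ℂ) i j := by
    intro i j
    rw [killingForm_so, soM]
    simp only [mul_sub, Matrix.trace_sub, Matrix.trace_mul_single]
    simp [hy i j]
    ring
  have h2 : ∀ p : Fin n × Fin n, killingForm ℂ (so (Fin n) ℂ) y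
      ((-(4 * ((n : ℂ) - 2))⁻¹) • soM p.1 p.2) =
        2⁻¹ * (y : Matrix (Fin n) (Fin n) ℂ) p.1 p.2 := by
    intro p
    rw [map_smul, h1, smul_eq_mul]
    field_simp
    norm_num
  ext : 1
  rw [Finset.sum_congr rfl fun p _ => congrArg (· • soM p.1 p.2) (h2 p),
    AddSubmonoidClass.coe_finsetSum, Fintype.sum_prod_type]
  change ∑ i, ∑ j, (2⁻¹ * (y : Matrix (Fin n) (Fin n) ℂ) i j) •
    ((Matrix.single i j (1 : ℂ) - Matrix.single j i 1 : Matrix (Fin n) (Fin n) ℂ)) =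
      (y : Matrix (Fin n) (Fin n) ℂ)
  exact sum_smul_single_sub_single ((mem_so _ _ _).1 y.2)

theorem spinLinear_single (i j : Fin n) :
    spinLinear n (Matrix.single i j 1) = (2 : ℂ)⁻¹ • spinM i j := by
  rw [spinLinear]
  simp only [LinearMap.coe_mk, AddHom.coe_mk]
  congr 1
  rw [Finset.sum_eq_single i, Finset.sum_eq_single j]
  · simp
  · intro l _ hl; simp [hl.symm]
  · simp
  · intro k _ hk; simp [hk.symm]
  · simp

theorem spinHom_soM (i j : Fin n) : spinHom n (soM i j) = spinM i j := by
  have h : spinHom n (soM i j) =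
      spinLinear n (Matrix.single i j 1 - Matrix.single j i 1) := rfl
  rw [h, map_sub, spinLinear_single, spinLinear_single, spinM_antisymm j i]
  module

end Killing

/-! ### Products of generators of the Clifford algebra -/

section Gamma

theorem prod_ofFn_comp_swap {A : Type*} [Ring A] {m : ℕ} (f : Fin (m + 1) → A) (j : Fin m)
    (h : f j.succ * f j.castSucc = -(f j.castSucc * f j.succ)) :
    (List.ofFn (f ∘ Equiv.swap j.castSucc j.succ)).prod = -(List.ofFn f).prod := by
  induction m with
  | zero => exact j.elim0
  | succ m ih =>
    induction j using Fin.cases with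
    | zero =>
      have e : ∀ a : Fin m, Equiv.swap (0 : Fin (m + 2)) (Fin.succ 0) a.succ.succ = a.succ.succ :=
        fun a => Equiv.swap_apply_of_ne_of_ne (Fin.succ_ne_zero _)
          fun h => Fin.succ_ne_zero _ (Fin.succ_injective _ h)
      simp only [Fin.castSucc_zero] at h ⊢
      simp only [List.ofFn_succ, List.prod_cons, Function.comp_apply, e, ← mul_assoc,
        Equiv.swap_apply_left, Equiv.swap_apply_right]
      rw [h, neg_mul]
    | succ j =>
      have e : ∀ a : Fin (m + 1), Equiv.swap j.succ.castSucc j.succ.succ a.succ =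
          (Equiv.swap j.castSucc j.succ a).succ := by
        intro a
        rw [← Fin.succ_castSucc]
        exact ((Fin.succ_injective _).swap_apply _ _ _)
      have e0 : Equiv.swap j.succ.castSucc j.succ.succ 0 = 0 :=
        Equiv.swap_apply_of_ne_of_ne (Fin.succ_castSucc j ▸ (Fin.succ_ne_zero _).symm)
          (Fin.succ_ne_zero _).symm
      rw [List.ofFn_succ, List.ofFn_succ (f := f), List.prod_cons, List.prod_cons, ← mul_neg]
      simp only [Function.comp_apply, e, e0]
      congr 1
      exact ih (fun a => f a.succ) j h

/-- Permuting a product of pairwise anticommuting factors multiplies it by the sign of the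
permutation, because adjacent transpositions generate the symmetric group. -/
theorem prod_ofFn_comp_perm {A : Type*} [Ring A] {k : ℕ} (f : Fin k → A)
    (h : ∀ a b, a ≠ b → f a * f b = -(f b * f a)) (σ : Equiv.Perm (Fin k)) :
    (List.ofFn (f ∘ σ)).prod = (Equiv.Perm.sign σ : ℤ) • (List.ofFn f).prod := by
  cases k with
  | zero => simp [Subsingleton.elim σ 1]
  | succ m =>
    have hσ : σ ∈ Submonoid.closure (Set.range fun i : Fin m => Equiv.swap i.castSucc i.succ) := by
      rw [Equiv.Perm.mclosure_swap_castSucc_succ]; trivial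
    induction hσ using Submonoid.closure_induction generalizing f with
    | mem x hx =>
      obtain ⟨j, rfl⟩ := hx
      have hj : j.castSucc ≠ j.succ := (Fin.castSucc_lt_succ).ne
      change (List.ofFn (f ∘ Equiv.swap j.castSucc j.succ)).prod = _
      rw [prod_ofFn_comp_swap f j (h _ _ hj.symm)]
      simp [Equiv.Perm.sign_swap hj]
    | one => simp
    | mul x y _ _ hx hy =>
      rw [Equiv.Perm.coe_mul, ← Function.comp_assoc,
        hy (f ∘ x) (fun a b hab => h _ _ (x.injective.ne hab)), hx f h, smul_smul, map_mul]
      simp [mul_comm]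

variable {n : ℕ}

theorem gamma_mul_self (i : Fin n) : (gamma i : Cl n) * gamma i = 1 := by
  have h := gamma_mul_add_swap i i
  rw [if_pos rfl, ← two_smul ℂ] at h
  exact smul_right_injective _ (two_ne_zero' ℂ) h

theorem gamma_anticomm {i j : Fin n} (h : i ≠ j) :
    (gamma i : Cl n) * gamma j = -(gamma j * gamma i) := by
  have := gamma_mul_add_swap i j
  rw [if_neg h, zero_smul] at this
  exact eq_neg_of_add_eq_zero_left this

theorem gammaAntisymm_of_injective {k : ℕ} (i : Fin k → Fin n) (hi : Function.Injective i) :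
    gammaAntisymm i = (List.ofFn fun a => (gamma (i a) : Cl n)).prod := by
  have h : ∀ σ : Equiv.Perm (Fin k), ((Equiv.Perm.sign σ : ℤ) : ℂ) •
      (List.ofFn fun a => (gamma (i (σ a)) : Cl n)).prod =
      (List.ofFn fun a => (gamma (i a) : Cl n)).prod := by
    intro σ
    have := prod_ofFn_comp_perm (fun a => (gamma (i a) : Cl n))
      (fun a b hab => gamma_anticomm (hi.ne hab)) σ
    rw [show (fun a => (gamma (i (σ a)) : Cl n)) = (fun a => (gamma (i a) : Cl n)) ∘ σ from rfl,
      this, Int.cast_smul_eq_zsmul, smul_smul]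
    simp
  rw [gammaAntisymm, Finset.sum_congr rfl fun σ _ => h σ, Finset.sum_const, Finset.card_univ,
    Fintype.card_perm, Fintype.card_fin, ← Nat.cast_smul_eq_nsmul ℂ, smul_smul,
    inv_mul_cancel₀ (Nat.cast_ne_zero.2 (Nat.factorial_ne_zero k)), one_smul]

theorem gammaAntisymm_of_not_injective {k : ℕ} (i : Fin k → Fin n)
    (hi : ¬ Function.Injective i) : gammaAntisymm i = 0 := by
  rw [Function.Injective] at hi
  push Not at hi
  obtain ⟨a, b, hab, hne⟩ := hi
  have hsw : ∀ c, i (Equiv.swap a b c) = i c := by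
    intro c
    rw [Equiv.swap_apply_def]
    split_ifs with h1 h2
    · rw [h1, hab]
    · rw [h2, hab]
    · rfl
  rw [gammaAntisymm]
  set S := ∑ σ : Equiv.Perm (Fin k), ((Equiv.Perm.sign σ : ℤ) : ℂ) •
    (List.ofFn fun c => (gamma (i (σ c)) : Cl n)).prod with hS
  have h : S = -S := by
    conv_lhs => rw [hS, ← Equiv.sum_comp (Equiv.mulLeft (Equiv.swap a b))]
    rw [hS, ← Finset.sum_neg_distrib]
    refine Finset.sum_congr rfl fun σ _ => ?_
    simp [hsw, Equiv.Perm.sign_swap hne]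
  have h2 : (2 : ℂ) • S = 0 := by
    rw [two_smul, ← eq_neg_iff_add_eq_zero]; exact h
  rw [(smul_eq_zero.1 h2).resolve_left two_ne_zero, smul_zero]

/-- The product of all the `Γ_i`, in increasing order. -/
def gammaTop (n : ℕ) : Cl n := ((List.finRange n).map gamma).prod

/-- Moving `Γ_i` through a product of generators gives one sign for each factor other than `Γ_i`
itself; the exponent is the number of those factors up to parity. -/
theorem gamma_mul_prod (i : Fin n) (l : List (Fin n)) :
    (gamma i : Cl n) * (l.map gamma).prod =
      (-1 : ℤ) ^ (l.length + l.count i) • ((l.map gamma).prod * gamma i) := by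
  induction l with
  | nil => simp
  | cons j l ih =>
    rw [List.map_cons, List.prod_cons, List.length_cons]
    by_cases h : i = j
    · subst h
      rw [mul_assoc, List.count_cons_self, ← mul_smul_comm, ih,
        show l.length + 1 + (l.count i + 1) = l.length + l.count i + 2 by ring,
        pow_add _ (l.length + l.count i) 2, neg_one_sq, mul_one]
    · rw [List.count_cons_of_ne (Ne.symm h), ← mul_assoc, gamma_anticomm h, neg_mul, mul_assoc, ih,
        mul_smul_comm, add_right_comm, pow_succ, ← mul_assoc]
      simp

/-- In even dimension the product of all generators anticommutes with each of them. -/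
theorem gamma_mul_gammaTop (hn : Even n) (i : Fin n) :
    (gamma i : Cl n) * gammaTop n = -(gammaTop n * gamma i) := by
  rw [gammaTop, gamma_mul_prod, List.length_finRange, List.count_finRange, hn.add_one.neg_one_pow]
  simp

theorem isUnit_gamma (i : Fin n) : IsUnit (gamma i : Cl n) :=
  ⟨⟨gamma i, gamma i, gamma_mul_self i, gamma_mul_self i⟩, rfl⟩

theorem isUnit_gammaTop (n : ℕ) : IsUnit (gammaTop n) := by
  rw [gammaTop]
  generalize List.finRange n = l
  induction l with
  | nil => simp
  | cons j l ih => simpa using (isUnit_gamma j).mul ih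

end Gamma

/-! ### The commuting involutions `ρ(Γ_i) ⊗ ρ(Γ_i)` -/

section Operators

variable (n : ℕ) (V : Type*) [AddCommGroup V] [Module ℂ V] [Module (Cl n) V]
  [IsScalarTower ℂ (Cl n) V]

/-- The map `x ↦ ρ(x) ⊗ ρ(x)`, multiplicative and quadratic in `x`. -/
def diagonalOp : Cl n →* Module.End ℂ (V ⊗[ℂ] V) where
  toFun x := TensorProduct.map (cliffordRep n V x) (cliffordRep n V x)
  map_one' := by rw [map_one]; exact TensorProduct.map_one
  map_mul' x y := by rw [map_mul]; exact TensorProduct.map_mul _ _ _ _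

variable {n}

theorem diagonalOp_smul (c : ℂ) (x : Cl n) : diagonalOp n V (c • x) = c ^ 2 • diagonalOp n V x := by
  change TensorProduct.map (cliffordRep n V (c • x)) (cliffordRep n V (c • x)) = _
  rw [map_smul, TensorProduct.map_smul_left, TensorProduct.map_smul_right, smul_smul, sq]
  rfl

theorem diagonalOp_neg (x : Cl n) : diagonalOp n V (-x) = diagonalOp n V x := by
  rw [← neg_one_smul ℂ x, diagonalOp_smul]; simp

/-- The operator `ρ(Γ_i) ⊗ ρ(Γ_i)`. -/
def pairOp (i : Fin n) : Module.End ℂ (V ⊗[ℂ] V) := diagonalOp n V (gamma i)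

theorem pairOp_mul_self (i : Fin n) : pairOp V i * pairOp V i = 1 := by
  rw [pairOp, ← map_mul, gamma_mul_self, map_one]

/-- The two signs from `Γ_i Γ_j = -Γ_j Γ_i` cancel. -/
theorem pairOp_comm (i j : Fin n) : pairOp V i * pairOp V j = pairOp V j * pairOp V i := by
  by_cases h : i = j
  · rw [h]
  · rw [pairOp, pairOp, ← map_mul, ← map_mul, gamma_anticomm h, diagonalOp_neg]

open Classical in
theorem invariantI_eq_sum (k : ℕ) : invariantI n V k = ∑ i : Fin k → Fin n,
    if Function.Injective i then (List.ofFn fun a => pairOp V (i a)).prod else 0 := by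
  refine Finset.sum_congr rfl fun i _ => ?_
  change diagonalOp n V (gammaAntisymm i) = _
  split_ifs with hi
  · rw [gammaAntisymm_of_injective i hi, map_list_prod, List.map_ofFn]
    rfl
  · rw [gammaAntisymm_of_not_injective i hi, ← zero_smul ℂ (1 : Cl n), diagonalOp_smul]
    simp

variable (n) in
/-- The commutative algebra of operators on `V ⊗ V` generated by the `ρ(Γ_i) ⊗ ρ(Γ_i)`. -/
abbrev pairAlgebra : Subalgebra ℂ (Module.End ℂ (V ⊗[ℂ] V)) :=
  Algebra.adjoin ℂ (Set.range (pairOp V : Fin n → _))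

instance : IsMulCommutative (pairAlgebra n V) :=
  Algebra.isMulCommutative_adjoin ℂ (by
    rintro _ ⟨i, rfl⟩ _ ⟨j, rfl⟩
    exact pairOp_comm V i j)

open scoped IsMulCommutative

/-- `ρ(Γ_i) ⊗ ρ(Γ_i)` as an element of the commutative algebra these operators generate. -/
def pairGen (i : Fin n) : pairAlgebra n V :=
  ⟨pairOp V i, Algebra.subset_adjoin ⟨i, rfl⟩⟩

theorem pairGen_mul_self (i : Fin n) : pairGen V i * pairGen V i = 1 :=
  Subtype.ext (pairOp_mul_self V i)

theorem invariantI_eq_distinctSum (k : ℕ) :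
    invariantI n V k = (distinctSum (pairGen V : Fin n → _) k : pairAlgebra n V) := by
  rw [invariantI_eq_sum, distinctSum]
  change _ = (pairAlgebra n V).val _
  rw [map_sum]
  refine Finset.sum_congr rfl fun i _ => ?_
  split_ifs
  · rw [← List.prod_ofFn, map_list_prod, List.map_ofFn]
    rfl
  · rw [map_zero]

theorem invariantI_zero : invariantI n V 0 = 1 := by
  rw [invariantI_eq_distinctSum, distinctSum_zero]; rfl

/-- The square of `∑ ρ(Γ_i) ⊗ ρ(Γ_i)` consists of the products of distinct involutions, which make
up `I_2`, and of `n` squares equal to `1`. -/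
theorem invariantI_two : invariantI n V 2 = (∑ i : Fin n, pairOp V i) ^ 2 - (n : ℂ) • 1 := by
  have h := congrArg (pairAlgebra n V).val
    (distinctSum_two (pairGen V : Fin n → _) (pairGen_mul_self V))
  simp only [map_sub, map_pow, map_sum, map_natCast] at h
  rw [invariantI_eq_distinctSum, Algebra.smul_def, map_natCast, mul_one]
  exact h

theorem invariantI_eq_zero {k : ℕ} (hk : n < k) : invariantI n V k = 0 := by
  rw [invariantI_eq_distinctSum, distinctSum_eq_zero _ hk]; rfl

theorem invariantI_add_four (m : ℕ) : invariantI n V (m + 4) =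
    invariantI n V (m + 2) * invariantI n V 2
      - (2 * (m + 2) * ((n : ℂ) - (m + 2))) • invariantI n V (m + 2)
      - ((m + 2) * (m + 1) * ((n : ℂ) - m) * (n - m - 1)) • invariantI n V m := by
  simp only [invariantI_eq_distinctSum]
  have h := congrArg (pairAlgebra n V).val
    (distinctSum_add_two (pairGen V : Fin n → _) (pairGen_mul_self V) m)
  simp only [map_sub, map_mul, map_add, map_natCast, map_ofNat, map_one] at h
  refine h.trans ?_
  simp only [Algebra.smul_def, map_sub, map_mul, map_add, map_natCast, map_ofNat, map_one]
  rfl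

theorem diagonalOp_spinM (i j : Fin n) : diagonalOp n V (spinM i j) =
    if i = j then 0 else (4 : ℂ)⁻¹ • (pairOp V i * pairOp V j) := by
  split_ifs with h
  · subst h
    rw [spinM, lie_self, smul_zero, ← zero_smul ℂ (1 : Cl n), diagonalOp_smul]
    simp
  · have : (spinM i j : Cl n) = (2 : ℂ)⁻¹ • (gamma i * gamma j) := by
      rw [spinM, Ring.lie_def, gamma_anticomm (Ne.symm h)]
      module
    rw [this, diagonalOp_smul, map_mul]
    norm_num [pairOp]

theorem sum_diagonalOp_spinM :
    ∑ i : Fin n, ∑ j : Fin n, diagonalOp n V (spinM i j) = (4 : ℂ)⁻¹ • invariantI n V 2 := by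
  have h : ∀ i j : Fin n, diagonalOp n V (spinM i j) =
      (4 : ℂ)⁻¹ • (pairOp V i * pairOp V j) - (if i = j then (4 : ℂ)⁻¹ • 1 else 0) := by
    intro i j
    rw [diagonalOp_spinM]
    split_ifs with h
    · rw [h, pairOp_mul_self, sub_self]
    · rw [sub_zero]
  simp only [h, Finset.sum_sub_distrib, Finset.sum_ite_eq, Finset.mem_univ, if_true,
    ← Finset.smul_sum, ← Finset.mul_sum, ← Finset.sum_mul]
  rw [invariantI_two, sq, smul_sub]
  simp [smul_smul, mul_comm, ← Nat.cast_smul_eq_nsmul ℂ]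

theorem splitCasimirOp_spinorRep (hn : (n : ℂ) - 2 ≠ 0) {κ : Type*} [Fintype κ] [DecidableEq κ]
    (b : Module.Basis κ ℂ (LieAlgebra.Orthogonal.so (Fin n) ℂ)) :
    splitCasimirOp b (spinorRep n V) = (-(16 * ((n : ℂ) - 2))⁻¹) • invariantI n V 2 := by
  have hT : ∀ i j, spinorRep n V (soM i j) = cliffordRep n V (spinM i j) := by
    intro i j
    rw [← spinHom_soM]; rfl
  rw [splitCasimirOp_eq_sum b (spinorRep n V) _ _ (sum_killingForm_soM hn)]
  simp only [map_smul, hT, TensorProduct.map_smul_left, ← Finset.smul_sum]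
  rw [Fintype.sum_prod_type]
  refine (congrArg _ (sum_diagonalOp_spinM V)).trans ?_
  rw [smul_smul]
  congr 1
  field_simp
  norm_num

end Operators

/-! ### Joint eigenvectors -/

section Eigenvectors

variable {n : ℕ} (V : Type*) [AddCommGroup V] [Module ℂ V] [Module (Cl n) V]
  [IsScalarTower ℂ (Cl n) V]

/-- The operator `ρ(Γ_a ω) ⊗ 1`, where `ω` is the product of all generators. In even dimension it
reverses the sign of the eigenvalue of `ρ(Γ_a) ⊗ ρ(Γ_a)` and keeps those of the other
`ρ(Γ_i) ⊗ ρ(Γ_i)`. -/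
def flipOp (a : Fin n) : Module.End ℂ (V ⊗[ℂ] V) :=
  TensorProduct.map (cliffordRep n V (gamma a * gammaTop n)) 1

theorem isUnit_flipOp (a : Fin n) : IsUnit (flipOp V a) := by
  obtain ⟨u, hu⟩ := ((isUnit_gamma a).mul (isUnit_gammaTop n)).map (cliffordRep n V)
  refine ⟨⟨TensorProduct.map u.1 1, TensorProduct.map u.2 1, ?_, ?_⟩, ?_⟩
  · rw [← TensorProduct.map_mul, u.3, one_mul, TensorProduct.map_one]
  · rw [← TensorProduct.map_mul, u.4, one_mul, TensorProduct.map_one]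
  · rw [flipOp, ← hu]

theorem pairOp_mul_flipOp_self (hn : Even n) (a : Fin n) :
    pairOp V a * flipOp V a = -(flipOp V a * pairOp V a) := by
  have h : (gamma a : Cl n) * (gamma a * gammaTop n) = -(gamma a * gammaTop n * gamma a) := by
    rw [mul_assoc, ← mul_neg, gamma_mul_gammaTop hn]
  change TensorProduct.map _ _ * TensorProduct.map _ _ =
    -(TensorProduct.map _ _ * TensorProduct.map _ _)
  rw [← TensorProduct.map_mul, ← TensorProduct.map_mul, ← map_mul, ← map_mul, h, map_neg, mul_one,
    one_mul]
  exact LinearMap.map_neg₂ (TensorProduct.mapBilinear (RingHom.id ℂ) V V V V) _ _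

theorem pairOp_mul_flipOp (hn : Even n) {a i : Fin n} (hi : i ≠ a) :
    pairOp V i * flipOp V a = flipOp V a * pairOp V i := by
  have h : (gamma i : Cl n) * (gamma a * gammaTop n) = gamma a * gammaTop n * gamma i := by
    rw [← mul_assoc, gamma_anticomm hi, neg_mul, mul_assoc, gamma_mul_gammaTop hn, mul_neg, neg_neg,
      mul_assoc]
  change TensorProduct.map _ _ * TensorProduct.map _ _ =
    TensorProduct.map _ _ * TensorProduct.map _ _
  rw [← TensorProduct.map_mul, ← TensorProduct.map_mul, ← map_mul, ← map_mul, h, mul_one, one_mul]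

/-- Every choice of signs occurs as the joint eigenvalues of the commuting involutions
`ρ(Γ_i) ⊗ ρ(Γ_i)`: project a vector to the required eigenspaces one index at a time, and if a
projection vanishes, reverse that single sign with `flipOp`. -/
theorem exists_joint_eigenvector [Nontrivial V] (hn : Even n) (ε : Fin n → ℂ)
    (hε : ∀ i, ε i * ε i = 1) : ∃ v : V ⊗[ℂ] V, v ≠ 0 ∧ ∀ i, pairOp V i v = ε i • v := by
  suffices h : ∀ s : Finset (Fin n), ∃ v : V ⊗[ℂ] V, v ≠ 0 ∧ ∀ i ∈ s, pairOp V i v = ε i • v by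
    simpa using h Finset.univ
  intro s
  induction s using Finset.induction_on with
  | empty =>
    obtain ⟨v, hv⟩ := exists_ne (0 : V ⊗[ℂ] V)
    exact ⟨v, hv, by simp⟩
  | insert a s ha ih =>
    obtain ⟨v, hv, h⟩ := ih
    have hsq : pairOp V a (pairOp V a v) = v :=
      LinearMap.congr_fun (pairOp_mul_self V a) v
    by_cases hw : v + ε a • pairOp V a v = 0
    -- The projection of `v` to the eigenspace of `ε a` vanishes, so that `v` has eigenvalue `-ε a`.
    · have hav : pairOp V a v = -(ε a • v) := by
        have := congrArg (ε a • ·) hw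
        simp only [smul_add, smul_smul, hε, one_smul, smul_zero] at this
        exact eq_neg_of_add_eq_zero_right this
      refine ⟨flipOp V a v, fun h0 => hv ?_, fun i hi => ?_⟩
      · obtain ⟨u, hu⟩ := isUnit_flipOp V a
        rw [← hu] at h0
        have := congrArg (u⁻¹ : (Module.End ℂ (V ⊗[ℂ] V))ˣ).1 h0
        rw [map_zero, ← Module.End.mul_apply] at this
        simpa using this
      · rcases Finset.mem_insert.1 hi with rfl | hi
        · have := LinearMap.congr_fun (pairOp_mul_flipOp_self V hn i) v
          simp only [Module.End.mul_apply, LinearMap.neg_apply, hav, map_neg, map_smul, neg_neg]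
            at this
          exact this
        · have := LinearMap.congr_fun (pairOp_mul_flipOp V hn (ne_of_mem_of_not_mem hi ha)) v
          simp only [Module.End.mul_apply, h i hi, map_smul] at this
          exact this
    · refine ⟨_, hw, fun i hi => ?_⟩
      rcases Finset.mem_insert.1 hi with rfl | hi
      · rw [map_add, map_smul, hsq, smul_add, smul_smul, hε, one_smul, add_comm]
      · have hc : pairOp V i (pairOp V a v) = pairOp V a (pairOp V i v) :=
          LinearMap.congr_fun (pairOp_comm V i a) v
        rw [map_add, map_smul, hc, h i hi, map_smul, smul_add, smul_comm]

/-- With `m` signs equal to `-1`, the sum of the involutions has eigenvalue `n - 2m`. -/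
theorem exists_sum_eigenvector [Nontrivial V] (hn : Even n) {m : ℕ} (hm : m ≤ n) :
    ∃ v : V ⊗[ℂ] V, v ≠ 0 ∧ (∑ i : Fin n, pairOp V i) v = ((n : ℂ) - 2 * m) • v := by
  obtain ⟨v, hv, h⟩ := exists_joint_eigenvector V hn
    (fun i : Fin n => if (i : ℕ) < m then -1 else 1) (by intro i; split_ifs <;> norm_num)
  refine ⟨v, hv, ?_⟩
  rw [LinearMap.sum_apply, Finset.sum_congr rfl fun i _ => h i, ← Finset.sum_smul]
  congr 1
  have hs : ∀ i : Fin n, (if (i : ℕ) < m then (-1 : ℂ) else 1) =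
      1 - 2 * (if (i : ℕ) < m then 1 else 0) := by
    intro i; split_ifs <;> norm_num
  rw [Finset.sum_congr rfl fun i _ => hs i, Finset.sum_sub_distrib, ← Finset.mul_sum,
    Fin.sum_univ_eq_sum_range (fun i => if i < m then (1 : ℂ) else 0), ← Finset.sum_filter]
  have : (Finset.range n).filter (· < m) = Finset.range m := by
    ext; simp; omega
  rw [this]; simp

theorem hasEigenvalue_splitCasimirOp [Nontrivial V] (hn : Even n) (hn2 : (n : ℂ) - 2 ≠ 0)
    {κ : Type*} [Fintype κ] [DecidableEq κ]
    (b : Module.Basis κ ℂ (LieAlgebra.Orthogonal.so (Fin n) ℂ)) {m : ℕ} (hm : m ≤ n) :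
    (splitCasimirOp b (spinorRep n V)).HasEigenvalue
      (-(16 * ((n : ℂ) - 2))⁻¹ * (((n : ℂ) - 2 * m) ^ 2 - n)) := by
  obtain ⟨v, hv, h⟩ := exists_sum_eigenvector V hn hm
  refine Module.End.hasEigenvalue_of_hasEigenvector (x := v) ⟨?_, hv⟩
  rw [Module.End.mem_eigenspace_iff, splitCasimirOp_spinorRep V hn2, LinearMap.smul_apply,
    invariantI_two, sq, LinearMap.sub_apply, Module.End.mul_apply, h, map_smul, h]
  simp only [LinearMap.smul_apply, Module.End.one_apply]
  module

end Eigenvectors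

/-! ### The polynomials `I_{2k}(x)` and characteristic identities -/

section Polynomials

theorem evenInvariantPoly_add_two (r k : ℕ) : evenInvariantPoly r (k + 2) =
    evenInvariantPoly r (k + 1) * (C (-16 * (2 * (r : ℂ) - 2)) * X)
      - C (8 * ((k : ℂ) + 1) * (r - (k + 1))) * evenInvariantPoly r (k + 1)
      - C (4 * ((k : ℂ) + 1) * (2 * (k + 1) - 1) * (r + 1 - (k + 1)) * (2 * r + 1 - 2 * (k + 1)))
        * evenInvariantPoly r k := rfl

theorem degree_evenInvariantPoly {r : ℕ} (hr : (2 * (r : ℂ) - 2) ≠ 0) :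
    ∀ k, (evenInvariantPoly r k).degree = k
  | 0 => by simp [evenInvariantPoly]
  | 1 => degree_C_mul_X (mul_ne_zero (by norm_num) hr)
  | k + 2 => by
    have h0 := degree_evenInvariantPoly hr k
    have h1 := degree_evenInvariantPoly hr (k + 1)
    have h2 : (evenInvariantPoly r (k + 1) * (C (-16 * (2 * (r : ℂ) - 2)) * X)).degree =
        ((k + 2 : ℕ) : WithBot ℕ) := by
      rw [degree_mul, h1, degree_C_mul_X (mul_ne_zero (by norm_num) hr)]; rfl
    have hlt : ∀ (c : ℂ) (p : ℂ[X]), p.degree < ((k + 2 : ℕ) : WithBot ℕ) →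
        (C c * p).degree < ((k + 2 : ℕ) : WithBot ℕ) := fun c p hp => by
      rw [← smul_eq_C_mul]; exact (degree_smul_le c p).trans_lt hp
    have h3 : ∀ c : ℂ, (C c * evenInvariantPoly r (k + 1)).degree < ((k + 2 : ℕ) : WithBot ℕ) :=
      fun c => hlt c _ (by rw [h1]; exact_mod_cast Nat.lt_succ_self _)
    have h4 : ∀ c : ℂ, (C c * evenInvariantPoly r k).degree < ((k + 2 : ℕ) : WithBot ℕ) :=
      fun c => hlt c _ (by rw [h0]; exact_mod_cast (by omega : k < k + 2))
    rw [evenInvariantPoly_add_two, sub_sub, degree_sub_eq_left_of_degree_lt, h2]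
    rw [h2]
    exact (degree_add_le _ _).trans_lt (max_lt (h3 _) (h4 _))

/-- The polynomials obey the same recurrence as the even invariants. -/
theorem invariantI_eq_aeval {r : ℕ} (V : Type*) [AddCommGroup V] [Module ℂ V]
    [Module (Cl (2 * r)) V] [IsScalarTower ℂ (Cl (2 * r)) V]
    {T : Module.End ℂ (V ⊗[ℂ] V)}
    (hT : invariantI (2 * r) V 2 = (-16 * (2 * (r : ℂ) - 2)) • T) :
    ∀ k, invariantI (2 * r) V (2 * k) = aeval T (evenInvariantPoly r k)
  | 0 => by rw [mul_zero, invariantI_zero, evenInvariantPoly, map_one]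
  | 1 => by
    rw [mul_one, hT, evenInvariantPoly, map_mul, aeval_C, aeval_X, Algebra.smul_def]
  | k + 2 => by
    have h1 : invariantI (2 * r) V (2 * k + 2) = _ := invariantI_eq_aeval V hT (k + 1)
    have h := invariantI_add_four (n := 2 * r) V (2 * k)
    rw [hT, h1, invariantI_eq_aeval V hT k] at h
    refine h.trans ?_
    rw [evenInvariantPoly_add_two]
    simp only [map_sub (aeval (R := ℂ) T), map_mul (aeval (R := ℂ) T), aeval_X,
      aeval_C, ← Algebra.smul_def]
    push_cast
    congr 2 <;> ring_nf

/-- A polynomial that annihilates `T`, of degree at most the number of known eigenvalues of `T`, is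
the characteristic identity of `T`. -/
theorem isCharacteristicIdentity_of_hasEigenvalue {W : Type*} [AddCommGroup W] [Module ℂ W]
    {T : Module.End ℂ W} {p : ℂ[X]} (hp : p ≠ 0) (hT : aeval T p = 0) (s : Finset ℂ)
    (hs : ∀ c ∈ s, T.HasEigenvalue c) (hcard : p.natDegree ≤ s.card) :
    IsCharacteristicIdentity T p := by
  have hroot : ∀ q : ℂ[X], q ≠ 0 → aeval T q = 0 → ∀ c, T.HasEigenvalue c → c ∈ q.roots := by
    intro q hq hq0 c hc
    obtain ⟨v, hv⟩ := hc.exists_hasEigenvector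
    have h := Module.End.aeval_apply_of_hasEigenvector (p := q) hv
    rw [hq0, LinearMap.zero_apply] at h
    rw [mem_roots hq]
    exact (smul_eq_zero.1 h.symm).resolve_right hv.2
  have hle : ∀ q : ℂ[X], q ≠ 0 → aeval T q = 0 → s.val ≤ q.roots := fun q hq hq0 =>
    (Multiset.le_iff_subset s.nodup).2 fun c hc => hroot q hq hq0 c (hs c hc)
  have hval : s.val = p.roots :=
    Multiset.eq_of_le_of_card_le (hle p hp hT) ((card_roots' p).trans hcard)
  refine ⟨hT, ⟨s, fun c => ⟨hs c, fun hc => ?_⟩, p.leadingCoeff, leadingCoeff_ne_zero.2 hp, ?_⟩,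
    fun q hq hq0 => ?_⟩
  · rw [← Finset.mem_val, hval]; exact hroot p hp hT c hc
  · rw [Finset.prod, hval]
    refine (C_leadingCoeff_mul_prod_multiset_X_sub_C (le_antisymm (card_roots' p) ?_)).symm
    rwa [← hval]
  · rw [degree_eq_natDegree hp, degree_eq_natDegree hq, Nat.cast_le]
    exact hcard.trans ((Multiset.card_le_card (hle q hq hq0)).trans (card_roots' q))

end Polynomials
end SpinorCasimir

end

theorem mainTheorem1 (r : ℕ) (hr : 2 ≤ r)
    (V : Type*) [AddCommGroup V] [Module ℂ V] [Module (SpinorCasimir.Cl (2 * r)) V]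
    [IsScalarTower ℂ (SpinorCasimir.Cl (2 * r)) V] [IsSimpleModule (SpinorCasimir.Cl (2 * r)) V]
    {κ : Type*} [Fintype κ] [DecidableEq κ]
    (b : Module.Basis κ ℂ (LieAlgebra.Orthogonal.so (Fin (2 * r)) ℂ)) :
    (∀ k : ℕ, (SpinorCasimir.evenInvariantPoly r k).natDegree = k ∧
      SpinorCasimir.invariantI (2 * r) V (2 * k) =
        aeval (SpinorCasimir.splitCasimirOp b (SpinorCasimir.spinorRep (2 * r) V))
          (SpinorCasimir.evenInvariantPoly r k)) ∧
    aeval (SpinorCasimir.splitCasimirOp b (SpinorCasimir.spinorRep (2 * r) V))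
      (SpinorCasimir.evenInvariantPoly r (r + 1)) = 0 ∧
    SpinorCasimir.IsCharacteristicIdentity
      (SpinorCasimir.splitCasimirOp b (SpinorCasimir.spinorRep (2 * r) V))
      (SpinorCasimir.evenInvariantPoly r (r + 1)) := by
  have hr0 : 2 * (r : ℂ) - 2 ≠ 0 := by
    rw [sub_ne_zero]
    exact_mod_cast (by omega : 2 * r ≠ 2)
  have hn2 : ((2 * r : ℕ) : ℂ) - 2 ≠ 0 := by push_cast; exact hr0
  have := IsSimpleModule.nontrivial (SpinorCasimir.Cl (2 * r)) V
  have hT := SpinorCasimir.splitCasimirOp_spinorRep V hn2 b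
  have hI := SpinorCasimir.invariantI_eq_aeval V
    (T := SpinorCasimir.splitCasimirOp b (SpinorCasimir.spinorRep (2 * r) V)) (by
      rw [hT, smul_smul]
      push_cast
      rw [neg_mul, neg_mul_neg, mul_inv_cancel₀ (mul_ne_zero (by norm_num) hr0), one_smul])
  have hdeg := SpinorCasimir.degree_evenInvariantPoly hr0
  have hzero : aeval (SpinorCasimir.splitCasimirOp b (SpinorCasimir.spinorRep (2 * r) V))
      (SpinorCasimir.evenInvariantPoly r (r + 1)) = 0 := by
    rw [← hI, SpinorCasimir.invariantI_eq_zero V (by omega)]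
  refine ⟨fun k => ⟨natDegree_eq_of_degree_eq_some (hdeg k), hI k⟩, hzero, ?_⟩
  have hp : SpinorCasimir.evenInvariantPoly r (r + 1) ≠ 0 := by
    rw [← degree_ne_bot, hdeg]
    exact WithBot.coe_ne_bot
  let c : ℕ → ℂ := fun m =>
    -(16 * (((2 * r : ℕ) : ℂ) - 2))⁻¹ * ((((2 * r : ℕ) : ℂ) - 2 * m) ^ 2 - (2 * r : ℕ))
  -- Up to scaling and shift the eigenvalues are `(2r - 2m)²`, and `m ≤ r` makes them distinct.
  have hinj : Set.InjOn c (Finset.range (r + 1)) := by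
    intro m hm l hl h
    have hm' : m ≤ r := by simpa [Nat.lt_succ_iff] using hm
    have hl' : l ≤ r := by simpa [Nat.lt_succ_iff] using hl
    have h1 := mul_left_cancel₀ (neg_ne_zero.2 (inv_ne_zero (mul_ne_zero (by norm_num) hn2))) h
    have h2 : ((r - m : ℕ) : ℂ) ^ 2 = ((r - l : ℕ) : ℂ) ^ 2 := by
      push_cast [hm', hl'] at h1 ⊢
      linear_combination h1 / 4
    have h3 : (r - m) ^ 2 = (r - l) ^ 2 := by exact_mod_cast h2
    have h4 := Nat.pow_left_injective two_ne_zero h3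
    omega
  refine SpinorCasimir.isCharacteristicIdentity_of_hasEigenvalue hp hzero
    ((Finset.range (r + 1)).image c) (fun x hx => ?_) ?_
  · obtain ⟨m, hm, rfl⟩ := Finset.mem_image.1 hx
    exact SpinorCasimir.hasEigenvalue_splitCasimirOp V (even_two_mul r) hn2 b
      (by have := Finset.mem_range.1 hm; omega)
  · rw [natDegree_eq_of_degree_eq_some (hdeg (r + 1)), Finset.card_image_of_injOn hinj,
      Finset.card_range]
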